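/- Let $\Theta=(V,E)$ be a finite simple oriented graph (no multiple arrows and no oriented cycles of length one or two); write $i\to j$ if $(i,j)\in E$. The Hecke--Kiselman monoid $\mathrm{HK}_\Theta$ is the monoid generated by idempotents $x_i$ ($i\in V$) subject to the relations $x_ix_j=x_jx_i$ if $i\neq j$ and there is no arrow between $i$ and $j$, and $x_ix_jx_i=x_jx_ix_j=x_ix_j$ if $i\to j$. The content of an element of $\mathrm{HK}_\Theta$ is the set of those $i\in V$ for which $x_i$ occurs in a word representing it; it does not depend on the word. If $X\subseteq V$ is such that the full subgraph $\Theta[X]$ has no oriented cycles, then there is exactly one idempotent of $\mathrm{HK}_\Theta$ with content $X$, and it is denoted by $e_X$. Let $X,Y\subseteq V$ be such that neither $\Theta[X]$ nor $\Theta[Y]$ contains an oriented cycle. Then $e_Xe_Y$ is an idempotent of $\mathrm{HK}_\Theta$ if and only if there do not exist $b\in Y\setminus X$, $a\in X\setminus Y$, an integer $r\ge 0$ and $i_1,\dots,i_r\in X\cap Y$ such that \[ b\to i_1\to\cdots\to i_r\to a \] (for $r=0$ this reads $b\to a$). Moreover, if $e_Xe_Y$ is an idempotent, then $\Theta[X\cup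 Y]$ contains no oriented cycles either, and $e_Xe_Y=e_{X\cup Y}$. -/

import Mathlib

/-- A simple oriented graph on the vertex type `V`: there is at most one arrow `i → j` for each
ordered pair (as `Adj` is a relation) and there are no oriented cycles of length two or one
(loops are excluded by `asymm` with `i = j`). -/
structure SimpleOrientedGraph (V : Type*) extends Digraph V where
  asymm : ∀ i j : V, Adj i j → ¬ Adj j i

namespace SimpleOrientedGraph

universe u

variable {V : Type u}

/-- The full subgraph `Θ[X]`. -/
def induce (Θ : SimpleOrientedGraph V) (X : Set V) : SimpleOrientedGraph X where
  Adj i j := Θ.Adj i j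
  asymm i j h := Θ.asymm i j h

/-- The graph contains no oriented cycle: no vertex can be reached from itself along a directed
walk with at least one arrow. -/
def IsAcyclic (Θ : SimpleOrientedGraph V) : Prop :=
  ∀ i : V, ¬ Relation.TransGen Θ.Adj i i

/-- The defining relations of the Hecke–Kiselman monoid. -/
inductive HKRel (Θ : SimpleOrientedGraph V) : FreeMonoid V → FreeMonoid V → Prop
  | idem (i : V) : HKRel Θ (.of i * .of i) (.of i)
  | comm (i j : V) (hne : i ≠ j) (hij : ¬ Θ.Adj i j) (hji : ¬ Θ.Adj j i) :
      HKRel Θ (.of i * .of j) (.of j * .of i)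
  | braid_left (i j : V) (hij : Θ.Adj i j) :
      HKRel Θ (.of i * .of j * .of i) (.of i * .of j)
  | braid_right (i j : V) (hij : Θ.Adj i j) :
      HKRel Θ (.of j * .of i * .of j) (.of i * .of j)

/-- The Hecke–Kiselman monoid of `Θ`. -/
abbrev HK (Θ : SimpleOrientedGraph V) : Type u := PresentedMonoid Θ.HKRel

/-- The generator `x_i`. -/
def x (Θ : SimpleOrientedGraph V) (i : V) : Θ.HK := PresentedMonoid.of Θ.HKRel i

/-- The congruence on words "the same letters occur". -/
def contentCon (V : Type u) : Con (FreeMonoid V) where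
  r w w' := ∀ i : V, i ∈ w.toList ↔ i ∈ w'.toList
  iseqv := ⟨fun _ _ => Iff.rfl, fun h i => (h i).symm, fun h h' i => (h i).trans (h' i)⟩
  mul' h h' i := by simp [h i, h' i]

theorem conGen_le_contentCon (Θ : SimpleOrientedGraph V) : conGen Θ.HKRel ≤ contentCon V := by
  refine Con.conGen_le.2 ?_
  intro w w' h i
  cases h <;> simp <;> tauto

/-- The content of `f`: the set of indices `i` such that `x_i` occurs in a word (equivalently,
in every word) representing `f`. -/
def content (Θ : SimpleOrientedGraph V) : Θ.HK → Set V :=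
  Quotient.lift (fun w : FreeMonoid V => {i | i ∈ w.toList})
    (fun _ _ h => Set.ext (Θ.conGen_le_contentCon h))

/-! ### Existence and uniqueness of the idempotent whose content is a given acyclic set -/

section Facts

variable (Θ : SimpleOrientedGraph V)

theorem content_mk (w : FreeMonoid V) :
    Θ.content (PresentedMonoid.mk Θ.HKRel w) = {i | i ∈ w.toList} := rfl

theorem content_one : Θ.content 1 = ∅ := by
  rw [← map_one (PresentedMonoid.mk Θ.HKRel), content_mk]
  simp

theorem content_x (i : V) : Θ.content (Θ.x i) = {i} := by
  rw [x, PresentedMonoid.of, content_mk]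
  ext j
  simp

theorem content_mul (f g : Θ.HK) : Θ.content (f * g) = Θ.content f ∪ Θ.content g := by
  obtain ⟨a, rfl⟩ := PresentedMonoid.surjective_mk f
  obtain ⟨b, rfl⟩ := PresentedMonoid.surjective_mk g
  rw [← map_mul]
  simp only [content_mk]
  ext j
  simp

theorem ind_right {P : Θ.HK → Prop} (h1 : P 1) (hm : ∀ f i, P f → P (f * Θ.x i)) (f : Θ.HK) :
    P f := by
  obtain ⟨a, rfl⟩ := PresentedMonoid.surjective_mk f
  induction a using List.reverseRecOn with
  | nil => exact h1
  | append_singleton l i ih => exact hm _ i ih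

theorem eq_one_of_content (f : Θ.HK) (h : Θ.content f = ∅) : f = 1 := by
  revert h
  refine Θ.ind_right (P := fun f => Θ.content f = ∅ → f = 1) (fun _ => rfl) ?_ f
  intro f i _ h
  have hi : i ∈ Θ.content (f * Θ.x i) := by
    rw [content_mul, content_x]
    exact Or.inr rfl
  rw [h] at hi
  exact hi.elim

theorem x_idem (i : V) : Θ.x i * Θ.x i = Θ.x i :=
  PresentedMonoid.mk_eq_mk_of_rel (HKRel.idem i)

theorem x_comm {i j : V} (hne : i ≠ j) (hij : ¬ Θ.Adj i j) (hji : ¬ Θ.Adj j i) :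
    Θ.x i * Θ.x j = Θ.x j * Θ.x i :=
  PresentedMonoid.mk_eq_mk_of_rel (HKRel.comm i j hne hij hji)

theorem x_braid_left {i j : V} (hij : Θ.Adj i j) : Θ.x i * Θ.x j * Θ.x i = Θ.x i * Θ.x j :=
  PresentedMonoid.mk_eq_mk_of_rel (HKRel.braid_left i j hij)

theorem x_braid_right {i j : V} (hij : Θ.Adj i j) : Θ.x j * Θ.x i * Θ.x j = Θ.x i * Θ.x j :=
  PresentedMonoid.mk_eq_mk_of_rel (HKRel.braid_right i j hij)

theorem x_left {s j : V} (h : ¬ Θ.Adj j s) : Θ.x s * Θ.x j * Θ.x s = Θ.x s * Θ.x j := by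
  by_cases hsj : Θ.Adj s j
  · exact Θ.x_braid_left hsj
  · rcases eq_or_ne s j with rfl | hne
    · rw [x_idem, x_idem]
    · rw [mul_assoc, ← Θ.x_comm hne hsj h, ← mul_assoc, x_idem]

theorem x_right {s j : V} (h : ¬ Θ.Adj j s) : Θ.x j * Θ.x s * Θ.x j = Θ.x s * Θ.x j := by
  by_cases hsj : Θ.Adj s j
  · exact Θ.x_braid_right hsj
  · rcases eq_or_ne s j with rfl | hne
    · rw [x_idem, x_idem]
    · rw [← Θ.x_comm hne hsj h, mul_assoc, x_idem]

theorem x_mul_mul_x (s : V) (f : Θ.HK) (h : ∀ j ∈ Θ.content f, ¬ Θ.Adj j s) :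
    Θ.x s * f * Θ.x s = Θ.x s * f := by
  revert h
  refine Θ.ind_right (P := fun f => (∀ j ∈ Θ.content f, ¬ Θ.Adj j s) →
    Θ.x s * f * Θ.x s = Θ.x s * f) ?_ ?_ f
  · intro _
    rw [mul_one, x_idem]
  · intro f j ih h
    have h1 := ih fun k hk => h k (by rw [content_mul]; exact Or.inl hk)
    have h2 : ¬ Θ.Adj j s := h j (by rw [content_mul, content_x]; exact Or.inr rfl)
    calc Θ.x s * (f * Θ.x j) * Θ.x s = (Θ.x s * f) * Θ.x j * Θ.x s := by simp only [mul_assoc]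
      _ = (Θ.x s * f * Θ.x s) * Θ.x j * Θ.x s := by rw [h1]
      _ = (Θ.x s * f) * (Θ.x s * Θ.x j * Θ.x s) := by simp only [mul_assoc]
      _ = (Θ.x s * f * Θ.x s) * Θ.x j := by rw [Θ.x_left h2]; simp only [mul_assoc]
      _ = Θ.x s * (f * Θ.x j) := by rw [h1, mul_assoc]

/-- Deleting all letters `x_s` does not depend on the representing word. -/
theorem exists_delete (s : V) : ∃ D : Θ.HK →* Θ.HK,
    D (Θ.x s) = 1 ∧ ∀ i, i ≠ s → D (Θ.x i) = Θ.x i := by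
  classical
  refine ⟨PresentedMonoid.lift (fun i => if i = s then 1 else Θ.x i) ?_, ?_, ?_⟩
  · intro a b h
    cases h with
    | idem i => simp only [map_mul, FreeMonoid.lift_eval_of]; split_ifs <;> simp [x_idem]
    | comm i j hne hij hji =>
      simp only [map_mul, FreeMonoid.lift_eval_of]
      split_ifs <;> simp [Θ.x_comm hne hij hji]
    | braid_left i j hij =>
      simp only [map_mul, FreeMonoid.lift_eval_of]
      split_ifs <;> simp [Θ.x_braid_left hij, x_idem]
    | braid_right i j hij =>
      simp only [map_mul, FreeMonoid.lift_eval_of]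
      split_ifs <;> simp [Θ.x_braid_right hij, x_idem]
  · simp [x]
  · intro i hi
    simp [x, hi]

theorem content_delete {s : V} {D : Θ.HK →* Θ.HK} (h1 : D (Θ.x s) = 1)
    (h2 : ∀ i, i ≠ s → D (Θ.x i) = Θ.x i) (f : Θ.HK) : Θ.content (D f) = Θ.content f \ {s} := by
  refine Θ.ind_right (P := fun f => Θ.content (D f) = Θ.content f \ {s}) ?_ ?_ f
  · simp [content_one]
  · intro f i ih
    rw [map_mul, content_mul, content_mul, ih, content_x, Set.union_sdiff_distrib]
    rcases eq_or_ne i s with rfl | hi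
    · simp [h1, content_one]
    · have : ({i} : Set V) \ {s} = {i} := by ext j; simp; rintro rfl; exact hi
      rw [h2 i hi, content_x, this]

theorem x_mul_delete {s : V} {D : Θ.HK →* Θ.HK} (h1 : D (Θ.x s) = 1)
    (h2 : ∀ i, i ≠ s → D (Θ.x i) = Θ.x i) (f : Θ.HK) (h : ∀ j ∈ Θ.content f, ¬ Θ.Adj j s) :
    Θ.x s * f = Θ.x s * D f := by
  revert h
  refine Θ.ind_right (P := fun f => (∀ j ∈ Θ.content f, ¬ Θ.Adj j s) →
    Θ.x s * f = Θ.x s * D f) ?_ ?_ f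
  · simp
  · intro f i ih h
    have hf : ∀ k ∈ Θ.content f, ¬ Θ.Adj k s :=
      fun k hk => h k (by rw [content_mul]; exact Or.inl hk)
    rw [map_mul, ← mul_assoc, ih hf, ← mul_assoc]
    rcases eq_or_ne i s with rfl | hi
    · rw [h1, mul_one]
      refine Θ.x_mul_mul_x i (D f) fun j hj => hf j ?_
      rw [Θ.content_delete h1 h2] at hj
      exact hj.1
    · rw [h2 i hi]

theorem exists_factor {s : V} (f : Θ.HK) (h : s ∈ Θ.content f) :
    ∃ a b : Θ.HK, f = a * Θ.x s * b := by
  revert h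
  refine Θ.ind_right (P := fun f => s ∈ Θ.content f → ∃ a b : Θ.HK, f = a * Θ.x s * b) ?_ ?_ f
  · simp [content_one]
  · intro f i ih h
    rw [content_mul, content_x] at h
    rcases h with h | h
    · obtain ⟨a, b, rfl⟩ := ih h
      exact ⟨a, b * Θ.x i, by simp only [mul_assoc]⟩
    · obtain rfl : s = i := h
      exact ⟨f, 1, by rw [mul_one]⟩

theorem absorb {X : Set V} {z : Θ.HK} (hz : ∀ i ∈ X, Θ.x i * z = z) (f : Θ.HK)
    (hf : Θ.content f ⊆ X) : f * z = z := by
  revert hf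
  refine Θ.ind_right (P := fun f => Θ.content f ⊆ X → f * z = z) ?_ ?_ f
  · simp
  · intro f i ih h
    rw [content_mul, content_x] at h
    rw [mul_assoc, hz i (h (Or.inr rfl)), ih fun j hj => h (Or.inl hj)]

variable {Θ}

theorem IsAcyclic.induce_mono {X Y : Set V} (hY : (Θ.induce Y).IsAcyclic) (h : X ⊆ Y) :
    (Θ.induce X).IsAcyclic := fun i hi =>
  hY ⟨i, h i.2⟩ (Relation.TransGen.lift (r := (Θ.induce X).Adj) (p := (Θ.induce Y).Adj)
    (fun j : X => (⟨j, h j.2⟩ : Y)) (fun _ _ hab => hab) _ _ hi)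

theorem IsAcyclic.exists_source [Finite V] {X : Set V} (hX : (Θ.induce X).IsAcyclic)
    (hne : X.Nonempty) : ∃ s ∈ X, ∀ j ∈ X, ¬ Θ.Adj j s := by
  have : Std.Irrefl (Relation.TransGen (Θ.induce X).Adj) := ⟨hX⟩
  have hw : WellFounded (Relation.TransGen (Θ.induce X).Adj) :=
    Finite.wellFounded_of_trans_of_irrefl _
  obtain ⟨i, hi⟩ := hne
  obtain ⟨s, -, hs⟩ := hw.has_min Set.univ ⟨⟨i, hi⟩, trivial⟩
  exact ⟨s, s.2, fun j hj hadj => hs ⟨j, hj⟩ trivial (Relation.TransGen.single hadj)⟩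

theorem IsAcyclic.exists_zero [Finite V] (n : ℕ) : ∀ {X : Set V}, X.ncard = n →
    (Θ.induce X).IsAcyclic → ∃ z : Θ.HK, Θ.content z = X ∧ (∀ i ∈ X, Θ.x i * z = z) ∧
      ∀ f : Θ.HK, IsIdempotentElem f → Θ.content f = X → f = z := by
  induction n with
  | zero =>
    intro X hn _
    obtain rfl : X = ∅ := (Set.ncard_eq_zero).1 hn
    exact ⟨1, Θ.content_one, by simp, fun f _ hf => Θ.eq_one_of_content f hf⟩
  | succ n ih =>
    intro X hn hX
    obtain ⟨s, hsX, hs⟩ := hX.exists_source ((Set.ncard_pos).1 (by omega))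
    obtain ⟨z, hzc, hz, hu⟩ := ih (X := X \ {s})
      (by rw [Set.ncard_sdiff_singleton_of_mem hsX]; omega) (hX.induce_mono Set.sdiff_subset)
    obtain ⟨D, h1, h2⟩ := Θ.exists_delete s
    have hz' : ∀ i ∈ X, Θ.x i * (Θ.x s * z) = Θ.x s * z := by
      intro i hi
      rcases eq_or_ne i s with rfl | hne
      · rw [← mul_assoc, x_idem]
      · have := hz i ⟨hi, hne⟩
        calc Θ.x i * (Θ.x s * z) = (Θ.x i * Θ.x s * Θ.x i) * z := by
              conv_lhs => rw [← this]
              simp only [mul_assoc]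
          _ = Θ.x s * z := by rw [Θ.x_right (hs i hi), mul_assoc, this]
    refine ⟨Θ.x s * z, ?_, hz', ?_⟩
    · rw [content_mul, content_x, hzc, Set.union_sdiff_cancel (Set.singleton_subset_iff.2 hsX)]
    · intro f hf hfc
      have hDf : D f = z := hu (D f) (hf.map D) (by rw [Θ.content_delete h1 h2, hfc])
      obtain ⟨a, b, hab⟩ := Θ.exists_factor (s := s) f (by rw [hfc]; exact hsX)
      have hsub : Θ.content a ∪ {s} ∪ Θ.content b = X := by
        rw [← hfc, hab, content_mul, content_mul, content_x]
      have haX : Θ.content a ⊆ X := fun j hj => hsub ▸ Or.inl (Or.inl hj)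
      have hbX : Θ.content b ⊆ X := fun j hj => hsub ▸ Or.inr hj
      have hDb : D b * z = z := Θ.absorb hz (D b) (by
        rw [Θ.content_delete h1 h2]; exact Set.sdiff_subset_sdiff_left hbX)
      have hbf : ∀ j ∈ Θ.content (b * f), ¬ Θ.Adj j s := by
        intro j hj
        rw [content_mul, hfc] at hj
        exact hs j (hj.elim (fun h => hbX h) id)
      calc f = a * Θ.x s * b * f := by rw [← hab, hf.eq]
        _ = a * (Θ.x s * (b * f)) := by simp only [mul_assoc]
        _ = a * (Θ.x s * (D b * D f)) := by rw [Θ.x_mul_delete h1 h2 _ hbf, map_mul]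
        _ = a * (Θ.x s * z) := by rw [hDf, hDb]
        _ = Θ.x s * z := Θ.absorb hz' a haX

/-- If `Θ[X]` has no oriented cycles, then there is exactly one idempotent with content `X`. -/
theorem IsAcyclic.existsUnique_idempotent [Finite V] {X : Set V} (hX : (Θ.induce X).IsAcyclic) :
    ∃! f : Θ.HK, IsIdempotentElem f ∧ Θ.content f = X := by
  obtain ⟨z, hzc, hz, hu⟩ := IsAcyclic.exists_zero X.ncard rfl hX
  exact ⟨z, ⟨Θ.absorb hz z hzc.le, hzc⟩, fun f hf => hu f hf.1 hf.2⟩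

end Facts

/-- `e_X`, for `Θ[X]` without oriented cycles: the unique idempotent of `HK Θ` with content `X`. -/
noncomputable def e [Finite V] (Θ : SimpleOrientedGraph V) (X : Set V)
    (hX : (Θ.induce X).IsAcyclic) : Θ.HK :=
  hX.existsUnique_idempotent.choose

theorem e_spec [Finite V] (Θ : SimpleOrientedGraph V) (X : Set V)
    (hX : (Θ.induce X).IsAcyclic) :
    IsIdempotentElem (Θ.e X hX) ∧ Θ.content (Θ.e X hX) = X :=
  hX.existsUnique_idempotent.choose_spec.1

/-- The condition `p(X, Y)`: there is no directed path `b → i₁ → ⋯ → i_r → a` with `r ≥ 0`,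
`b ∈ Y \ X`, `a ∈ X \ Y` and `i₁, …, i_r ∈ X ∩ Y`. -/
def p (Θ : SimpleOrientedGraph V) (X Y : Set V) : Prop :=
  ¬ ∃ b ∈ Y \ X, ∃ a ∈ X \ Y, ∃ l : List V, (∀ i ∈ l, i ∈ X ∩ Y) ∧
    List.IsChain Θ.Adj (b :: (l ++ [a]))

end SimpleOrientedGraph

/-! Let `R` be the set `reach X Y`; it contains `Y \ X` and lies in `Y`. Under `p X Y` no arrow
leaves `R` inside `X ∪ Y`. Hence `e_X = e_{X \ R} e_{X ∩ R}`, and `e_Y` absorbs the second factor,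
so `e_X e_Y = e_{X \ R} e_Y`. This product absorbs from the left every generator of its content, so
it is idempotent (`p.isIdempotentElem`).

Conversely, `HK` acts on markings of the vertices: `x_v` marks `v` exactly when `v ∈ B` or a
predecessor is marked. With `B = Y \ X`, apply `e_X e_Y` to the empty marking: `b` becomes marked
and `a` does not. Idempotence makes the result a fixed point, but applying `e_X` to it carries the
mark from `b` along the path to `a`, which `e_Y` cannot erase (`p_of_isIdempotentElem`). The
equality with `e_{X ∪ Y}` is uniqueness of the idempotent with given content. -/

namespace SimpleOrientedGraph

/-! ### Absorption and factorization of the idempotents `e_X`. -/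

section Idempotents

variable {V : Type*} (Θ : SimpleOrientedGraph V)

/-- An element absorbing all generators in its content is idempotent. -/
theorem isIdempotentElem_of_absorb {f : Θ.HK} (hf : ∀ i ∈ Θ.content f, Θ.x i * f = f) :
    IsIdempotentElem f :=
  Θ.absorb hf f subset_rfl

/-- Mirror image of `x_mul_mul_x`: `x_j x_s = x_s x_j x_s` creates a second `x_s` just after `f`, so
that the induction hypothesis removes the leftmost one. -/
theorem x_mul_mul_x_of_not_adj (s : V) (f : Θ.HK) (h : ∀ j ∈ Θ.content f, ¬ Θ.Adj s j) :
    Θ.x s * f * Θ.x s = f * Θ.x s := by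
  revert h
  refine Θ.ind_right (P := fun f => (∀ j ∈ Θ.content f, ¬ Θ.Adj s j) →
    Θ.x s * f * Θ.x s = f * Θ.x s) ?_ ?_ f
  · intro _
    rw [mul_one, one_mul, x_idem]
  · intro f j ih h
    have h1 := ih fun k hk => h k (by rw [content_mul]; exact Or.inl hk)
    have h2 : ¬ Θ.Adj s j := h j (by rw [content_mul, content_x]; exact Or.inr rfl)
    calc Θ.x s * (f * Θ.x j) * Θ.x s = Θ.x s * f * (Θ.x j * Θ.x s) := by simp only [mul_assoc]
      _ = (Θ.x s * f * Θ.x s) * Θ.x j * Θ.x s := by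
        rw [← Θ.x_right h2]; simp only [mul_assoc]
      _ = f * (Θ.x s * Θ.x j * Θ.x s) := by rw [h1]; simp only [mul_assoc]
      _ = f * Θ.x j * Θ.x s := by rw [Θ.x_right h2, mul_assoc]

variable [Finite V] {X Y : Set V}

theorem e_eq (hX : (Θ.induce X).IsAcyclic) {f : Θ.HK} (hf : IsIdempotentElem f)
    (hc : Θ.content f = X) : f = Θ.e X hX :=
  hX.existsUnique_idempotent.unique ⟨hf, hc⟩ (Θ.e_spec X hX)

theorem x_mul_e (hX : (Θ.induce X).IsAcyclic) {i : V} (hi : i ∈ X) :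
    Θ.x i * Θ.e X hX = Θ.e X hX := by
  obtain ⟨z, -, hz, hu⟩ := IsAcyclic.exists_zero X.ncard rfl hX
  rw [hu _ (Θ.e_spec X hX).1 (Θ.e_spec X hX).2, hz i hi]

/-- Right absorption follows from left absorption by uniqueness: `e_X x_i` is again idempotent with
content `X`. -/
theorem e_mul_x (hX : (Θ.induce X).IsAcyclic) {i : V} (hi : i ∈ X) :
    Θ.e X hX * Θ.x i = Θ.e X hX := by
  refine Θ.e_eq hX ?_ ?_
  · rw [IsIdempotentElem, ← mul_assoc, mul_assoc (Θ.e X hX), Θ.x_mul_e hX hi, (Θ.e_spec X hX).1]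
  · rw [content_mul, content_x, (Θ.e_spec X hX).2,
      Set.union_eq_self_of_subset_right (Set.singleton_subset_iff.2 hi)]

/-- If there is no arrow from `i` to `A`, then `x_i` is absorbed by `e_A e_Y` for `i ∈ Y`. -/
theorem x_mul_e_mul_e {A : Set V} (hA : (Θ.induce A).IsAcyclic) (hY : (Θ.induce Y).IsAcyclic)
    {i : V} (hi : i ∈ Y) (h : ∀ j ∈ A, ¬ Θ.Adj i j) :
    Θ.x i * (Θ.e A hA * Θ.e Y hY) = Θ.e A hA * Θ.e Y hY := by
  calc Θ.x i * (Θ.e A hA * Θ.e Y hY)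
      -- The second `x_i` is borrowed from `e_Y = x_i e_Y`; it makes the first one redundant.
      = Θ.x i * Θ.e A hA * Θ.x i * Θ.e Y hY := by
        rw [mul_assoc (Θ.x i * _), Θ.x_mul_e hY hi, mul_assoc]
    _ = Θ.e A hA * Θ.e Y hY := by
        rw [Θ.x_mul_mul_x_of_not_adj i _ (by rwa [(Θ.e_spec A hA).2]), mul_assoc,
          Θ.x_mul_e hY hi]

/-- If there is no arrow from `C` to `A`, then `e_A e_C = e_{A ∪ C}`. -/
theorem e_mul_e_of_not_adj {A C : Set V} (hA : (Θ.induce A).IsAcyclic)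
    (hC : (Θ.induce C).IsAcyclic) (hX : (Θ.induce X).IsAcyclic) (hAC : A ∪ C = X)
    (h : ∀ i ∈ C, ∀ j ∈ A, ¬ Θ.Adj i j) : Θ.e A hA * Θ.e C hC = Θ.e X hX := by
  have hc : Θ.content (Θ.e A hA * Θ.e C hC) = A ∪ C := by
    rw [content_mul, (Θ.e_spec A hA).2, (Θ.e_spec C hC).2]
  refine Θ.e_eq hX (Θ.isIdempotentElem_of_absorb ?_) (hc.trans hAC)
  rw [hc]
  rintro i (hi | hi)
  · rw [← mul_assoc, Θ.x_mul_e hA hi]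
  · exact Θ.x_mul_e_mul_e hA hC hi (h i hi)

end Idempotents

/-! ### Reachability from `Y \ X`, and sufficiency of `p X Y`. -/

section Paths

variable {V : Type*} (Θ : SimpleOrientedGraph V)

/-- The vertices reachable from `Y \ X` by directed paths whose further vertices lie in
`X ∩ Y`. -/
def reach (X Y : Set V) : Set V :=
  {v | ∃ b ∈ Y \ X, ∃ l : List V, (∀ i ∈ l, i ∈ X ∩ Y) ∧ List.IsChain Θ.Adj (b :: l) ∧
    v ∈ (b :: l).getLast?}

variable {Θ} {X Y : Set V}

theorem subset_reach : Y \ X ⊆ Θ.reach X Y :=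
  fun b hb => ⟨b, hb, [], by simp, by simp, by simp⟩

theorem reach_subset : Θ.reach X Y ⊆ Y := by
  rintro v ⟨b, hb, l, hl, -, hv⟩
  rcases List.mem_cons.1 (List.mem_of_getLast? hv) with rfl | h
  · exact hb.1
  · exact (hl v h).2

/-- Under `p X Y`, the reachable set is closed under successors inside `X ∪ Y`. -/
theorem p.mem_reach (hp : Θ.p X Y) {v w : V} (hv : v ∈ Θ.reach X Y) (hvw : Θ.Adj v w)
    (hw : w ∈ X ∪ Y) : w ∈ Θ.reach X Y := by
  by_cases hwX : w ∈ X
  · obtain ⟨b, hb, l, hl, hc, hlast⟩ := hv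
    have hc' : List.IsChain Θ.Adj (b :: (l ++ [w])) := by
      rw [← List.cons_append, List.isChain_append]
      refine ⟨hc, by simp, fun u hu y hy => ?_⟩
      obtain rfl : v = u := Option.mem_unique hlast hu
      obtain rfl : w = y := by simpa using hy
      exact hvw
    by_cases hwY : w ∈ Y
    · refine ⟨b, hb, l ++ [w], ?_, hc', by simp [List.getLast?_cons]⟩
      intro i hi
      rcases List.mem_append.1 hi with hi | hi
      · exact hl i hi
      · rw [List.mem_singleton.1 hi]
        exact ⟨hwX, hwY⟩
    -- Here `w ∈ X \ Y` would complete a forbidden path.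
    · exact (hp ⟨b, hb, w, ⟨hwX, hwY⟩, l, hl, hc'⟩).elim
  · exact subset_reach ⟨hw.resolve_left hwX, hwX⟩

theorem p.transGen_of_mem_reach (hp : Θ.p X Y) {i j : ↥(X ∪ Y)}
    (h : Relation.TransGen (Θ.induce (X ∪ Y)).Adj i j) (hi : i.1 ∈ Θ.reach X Y) :
    ∃ hj : j.1 ∈ Θ.reach X Y, Relation.TransGen (Θ.induce Y).Adj
      ⟨i, reach_subset hi⟩ ⟨j, reach_subset hj⟩ := by
  induction h with
  | single hij => exact ⟨hp.mem_reach hi hij (Subtype.prop _), .single hij⟩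
  | tail _ hjk ih =>
    obtain ⟨hj, hij⟩ := ih
    exact ⟨hp.mem_reach hj hjk (Subtype.prop _), hij.tail hjk⟩

theorem mem_of_notMem_reach {v : V} (hv : v ∈ X ∪ Y) (h : v ∉ Θ.reach X Y) : v ∈ X :=
  by_contra fun hX => h (subset_reach ⟨hv.resolve_left hX, hX⟩)

theorem p.transGen_of_notMem_reach (hp : Θ.p X Y) {i j : ↥(X ∪ Y)}
    (h : Relation.TransGen (Θ.induce (X ∪ Y)).Adj i j) (hj : j.1 ∉ Θ.reach X Y) :
    ∃ (hi : i.1 ∈ X) (hj : j.1 ∈ X), Relation.TransGen (Θ.induce X).Adj ⟨i, hi⟩ ⟨j, hj⟩ := by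
  induction h with
  | single hij =>
    exact ⟨mem_of_notMem_reach i.2 fun hi => hj (hp.mem_reach hi hij (Subtype.prop _)),
      mem_of_notMem_reach (Subtype.prop _) hj, .single hij⟩
  | tail _ hjk ih =>
    obtain ⟨hi, hj', hij⟩ := ih fun h => hj (hp.mem_reach h hjk (Subtype.prop _))
    exact ⟨hi, mem_of_notMem_reach (Subtype.prop _) hj, hij.tail hjk⟩

/-- A cycle meeting `reach X Y` never leaves it and so lies in `Y`; any other cycle avoids it and so
lies in `X`. -/
theorem p.isAcyclic_union (hp : Θ.p X Y) (hX : (Θ.induce X).IsAcyclic)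
    (hY : (Θ.induce Y).IsAcyclic) : (Θ.induce (X ∪ Y)).IsAcyclic := by
  intro i hi
  by_cases h : i.1 ∈ Θ.reach X Y
  · exact hY _ (hp.transGen_of_mem_reach hi h).2
  · obtain ⟨_, _, h'⟩ := hp.transGen_of_notMem_reach hi h
    exact hX _ h'

theorem p.isIdempotentElem [Finite V] (hp : Θ.p X Y) (hX : (Θ.induce X).IsAcyclic)
    (hY : (Θ.induce Y).IsAcyclic) : IsIdempotentElem (Θ.e X hX * Θ.e Y hY) := by
  have hA := hX.induce_mono (X := X \ Θ.reach X Y) Set.sdiff_subset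
  have hC := hX.induce_mono (X := X ∩ Θ.reach X Y) Set.inter_subset_left
  have hsplit : Θ.e (X \ Θ.reach X Y) hA * Θ.e (X ∩ Θ.reach X Y) hC = Θ.e X hX :=
    Θ.e_mul_e_of_not_adj hA hC hX (Set.sdiff_union_inter _ _)
      fun i hi j hj hij => hj.2 (hp.mem_reach hi.2 hij (Or.inl hj.1))
  have habs : Θ.e (X ∩ Θ.reach X Y) hC * Θ.e Y hY = Θ.e Y hY :=
    Θ.absorb (fun i hi => Θ.x_mul_e hY hi) _
      (by rw [(Θ.e_spec _ hC).2]; exact Set.inter_subset_right.trans reach_subset)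
  apply Θ.isIdempotentElem_of_absorb
  rw [content_mul, (Θ.e_spec X hX).2, (Θ.e_spec Y hY).2]
  intro i hi
  by_cases hiX : i ∈ X
  · rw [← mul_assoc, Θ.x_mul_e hX hiX]
  · have hiY := hi.resolve_left hiX
    rw [← hsplit, mul_assoc, habs]
    exact Θ.x_mul_e_mul_e hA hY hiY
      fun j hj hij => hj.2 (hp.mem_reach (subset_reach ⟨hiY, hiX⟩) hij (Or.inl hj.1))

end Paths

/-! ### The action on markings. -/

section Action

variable {V : Type*} (Θ : SimpleOrientedGraph V) (B : Set V)

open Classical in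
/-- Updating a marking of the vertices at `v`: the vertex `v` becomes marked if it belongs to `B`
or has a marked predecessor, and unmarked otherwise. -/
def step (v : V) (f : V → Prop) : V → Prop :=
  Function.update f v (v ∈ B ∨ ∃ u, Θ.Adj u v ∧ f u)

theorem step_self (v : V) (f : V → Prop) :
    Θ.step B v f v = (v ∈ B ∨ ∃ u, Θ.Adj u v ∧ f u) := by
  simp [step]

theorem step_of_ne {v w : V} (h : w ≠ v) (f : V → Prop) : Θ.step B v f w = f w := by
  simp [step, h]

theorem step_self_congr {v : V} {f g : V → Prop} (h : ∀ u, Θ.Adj u v → f u = g u) :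
    Θ.step B v f v = Θ.step B v g v := by
  rw [step_self, step_self]
  congr! 3 with u
  exact and_congr_right fun hu => iff_of_eq (h u hu)

theorem step_step_self_of_not_adj {i j : V} (hij : ¬ Θ.Adj j i) (f : V → Prop) :
    Θ.step B i (Θ.step B j f) i = Θ.step B i f i :=
  Θ.step_self_congr B fun u hu => Θ.step_of_ne B (by rintro rfl; exact hij hu) f

theorem step_eq_self_iff {v : V} {f : V → Prop} :
    Θ.step B v f = f ↔ Θ.step B v f v = f v := by
  refine ⟨fun h => by rw [h], fun h => funext fun w => ?_⟩
  rcases eq_or_ne w v with rfl | hw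
  · exact h
  · exact Θ.step_of_ne B hw f

theorem not_adj_self (i : V) : ¬ Θ.Adj i i := fun h => Θ.asymm i i h h

theorem step_idem (i : V) (f : V → Prop) : Θ.step B i (Θ.step B i f) = Θ.step B i f :=
  (Θ.step_eq_self_iff B).2 (Θ.step_step_self_of_not_adj B (Θ.not_adj_self i) f)

/-- The action of the Hecke–Kiselman monoid on markings, letters acting from left to right. -/
theorem exists_action : ∃ φ : Θ.HK →* (Function.End (V → Prop))ᵐᵒᵖ,
    ∀ i, φ (Θ.x i) = .op (Θ.step B i) := by
  refine ⟨PresentedMonoid.lift (fun i => .op (Θ.step B i)) ?_, ?_⟩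
  swap
  · intro i
    exact PresentedMonoid.lift_of _ _
  intro a b h
  cases h with
  | idem i =>
    simp only [map_mul, FreeMonoid.lift_eval_of]
    exact congrArg MulOpposite.op (funext fun f => Θ.step_idem B i f)
  | comm i j hne hij hji =>
    simp only [map_mul, FreeMonoid.lift_eval_of]
    refine congrArg MulOpposite.op (funext fun f => funext fun w => ?_)
    change Θ.step B j (Θ.step B i f) w = Θ.step B i (Θ.step B j f) w
    rcases eq_or_ne w i with rfl | hi
    · rw [step_of_ne _ _ hne, Θ.step_step_self_of_not_adj B hji]
    · rw [Θ.step_of_ne B hi (Θ.step B j f)]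
      rcases eq_or_ne w j with rfl | hj
      · rw [Θ.step_step_self_of_not_adj B hij]
      · rw [step_of_ne _ _ hj, step_of_ne _ _ hi, step_of_ne _ _ hj]
  | braid_left i j hij =>
    simp only [map_mul, FreeMonoid.lift_eval_of]
    refine congrArg MulOpposite.op (funext fun f => ?_)
    change Θ.step B i (Θ.step B j (Θ.step B i f)) = Θ.step B j (Θ.step B i f)
    have hji := Θ.asymm i j hij
    rw [step_eq_self_iff, Θ.step_step_self_of_not_adj B hji, step_idem,
      Θ.step_of_ne B (w := i) (v := j) (by rintro rfl; exact hji hij)]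
  | braid_right i j hij =>
    simp only [map_mul, FreeMonoid.lift_eval_of]
    refine congrArg MulOpposite.op (funext fun f => funext fun w => ?_)
    change Θ.step B j (Θ.step B i (Θ.step B j f)) w = Θ.step B j (Θ.step B i f) w
    -- The first update of `j` is lost: `j` is not a predecessor of `i`, and the last update
    -- overwrites `j`.
    have hji := Θ.asymm i j hij
    rcases eq_or_ne w j with rfl | hj
    · refine Θ.step_self_congr B fun u hu => ?_
      rcases eq_or_ne u i with rfl | hi
      · rw [Θ.step_step_self_of_not_adj B hji]
      · rw [step_of_ne _ _ hi, step_of_ne _ _ hi,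
          step_of_ne _ _ (by rintro rfl; exact Θ.not_adj_self _ hu)]
    · rw [step_of_ne _ _ hj, step_of_ne _ _ hj]
      rcases eq_or_ne w i with rfl | hi
      · rw [Θ.step_step_self_of_not_adj B hji]
      · rw [step_of_ne _ _ hi, step_of_ne _ _ hi, step_of_ne _ _ hj]

/-- The action of the Hecke–Kiselman monoid on markings. -/
noncomputable def act : Θ.HK →* (Function.End (V → Prop))ᵐᵒᵖ := (Θ.exists_action B).choose

/-- The marking obtained from `g` by applying the letters of `f` from left to right. -/
noncomputable def mark (f : Θ.HK) (g : V → Prop) : V → Prop := (Θ.act B f).unop g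

theorem mark_mul (f f' : Θ.HK) (g : V → Prop) :
    Θ.mark B (f * f') g = Θ.mark B f' (Θ.mark B f g) := by
  simp only [mark, map_mul, MulOpposite.unop_mul]
  rfl

theorem mark_one (g : V → Prop) : Θ.mark B 1 g = g := by
  simp only [mark, map_one, MulOpposite.unop_one]
  rfl

theorem mark_x (i : V) (g : V → Prop) : Θ.mark B (Θ.x i) g = Θ.step B i g := by
  rw [mark, act, (Θ.exists_action B).choose_spec i]
  rfl

theorem mark_of_notMem {v : V} (f : Θ.HK) (g : V → Prop) (h : v ∉ Θ.content f) :
    Θ.mark B f g v = g v := by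
  revert h
  refine Θ.ind_right (P := fun f => v ∉ Θ.content f → Θ.mark B f g v = g v) ?_ ?_ f
  · intro _
    rw [mark_one]
  · intro f i ih h
    rw [content_mul, content_x] at h
    rw [mark_mul, mark_x, step_of_ne _ _ fun h' => h (Or.inr h'), ih fun h' => h (Or.inl h')]

theorem mark_false (f : Θ.HK) (h : Disjoint (Θ.content f) B) :
    Θ.mark B f (fun _ => False) = fun _ => False := by
  revert h
  refine Θ.ind_right (P := fun f => Disjoint (Θ.content f) B →
    Θ.mark B f (fun _ => False) = fun _ => False) ?_ ?_ f
  · intro _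
    rw [mark_one]
  · intro f i ih h
    rw [content_mul, content_x, Set.disjoint_union_left, Set.disjoint_singleton_left] at h
    rw [mark_mul, ih h.1, mark_x, step_eq_self_iff, step_self]
    simp [h.2]

variable [Finite V] {X Y : Set V}

/-- Since `e_X x_v = e_X`, the marking left by `e_X` is stable under updating any vertex of `X`;
this lets marks propagate along arrows into `X`. -/
theorem mark_e_self (hX : (Θ.induce X).IsAcyclic) (g : V → Prop) {v : V} (hv : v ∈ X) :
    Θ.mark B (Θ.e X hX) g v = (v ∈ B ∨ ∃ u, Θ.Adj u v ∧ Θ.mark B (Θ.e X hX) g u) := by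
  rw [← step_self, ← mark_x, ← mark_mul, Θ.e_mul_x hX hv]

end Action

/-! ### Necessity of `p X Y`. -/

theorem _root_.List.IsChain.forall_mem_of_step {α : Type*} {r : α → α → Prop} {P : α → Prop} :
    ∀ {l : List α} {b : α}, (b :: l).IsChain r → P b →
      (∀ u, ∀ w ∈ l, r u w → P u → P w) → ∀ w ∈ l, P w
  | [], _, _, _, _ => by simp
  | c :: l, b, h, hb, hs => by
    rw [List.isChain_cons_cons] at h
    have hc : P c := hs b c (by simp) h.1 hb
    intro w hw
    rcases List.mem_cons.1 hw with rfl | hw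
    · exact hc
    · exact h.2.forall_mem_of_step hc (fun u w hw => hs u w (by simp [hw])) w hw

theorem p_of_isIdempotentElem {V : Type*} [Finite V] {Θ : SimpleOrientedGraph V} {X Y : Set V}
    (hX : (Θ.induce X).IsAcyclic) (hY : (Θ.induce Y).IsAcyclic)
    (h : IsIdempotentElem (Θ.e X hX * Θ.e Y hY)) : Θ.p X Y := by
  rintro ⟨b, hb, a, ha, l, hl, hc⟩
  have hXc := (Θ.e_spec X hX).2
  have hYc := (Θ.e_spec Y hY).2
  set g : V → Prop := Θ.mark (Y \ X) (Θ.e X hX * Θ.e Y hY) (fun _ => False) with hg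
  -- The factor `e_X` acts trivially on the empty marking, as `X` misses `Y \ X`.
  have hg' : g = Θ.mark (Y \ X) (Θ.e Y hY) (fun _ => False) := by
    rw [hg, mark_mul, mark_false _ _ _ (by rw [hXc]; exact Set.disjoint_sdiff_right)]
  have hga : ¬ g a := by
    rw [hg', mark_of_notMem _ _ _ _ (by rw [hYc]; exact ha.2)]
    exact id
  have hgb : g b := by
    rw [hg', mark_e_self _ _ hY _ hb.1]
    exact Or.inl hb
  have hgg : Θ.mark (Y \ X) (Θ.e X hX * Θ.e Y hY) g = g := by
    rw [hg, ← mark_mul, h.eq]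
  -- As `a ∉ Y`, its mark after `e_X e_Y` is already decided by `e_X`.
  have hka : ¬ Θ.mark (Y \ X) (Θ.e X hX) g a := by
    rwa [← hgg, mark_mul, mark_of_notMem _ _ _ _ (by rw [hYc]; exact ha.2)] at hga
  refine hka (hc.forall_mem_of_step (P := Θ.mark (Y \ X) (Θ.e X hX) g) ?_ ?_ a (by simp))
  · rwa [mark_of_notMem _ _ _ _ (by rw [hXc]; exact hb.2)]
  · intro u w hw huw hu
    have hwX : w ∈ X := by
      rcases List.mem_append.1 hw with hw | hw
      · exact (hl w hw).1
      · rw [List.mem_singleton.1 hw]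
        exact ha.1
    rw [mark_e_self _ _ hX _ hwX]
    exact Or.inr ⟨u, huw, hu⟩

end SimpleOrientedGraph

/-- Let `X`, `Y` be sets of vertices with acyclic induced subgraphs. Then `e_X e_Y` is idempotent
if and only if `p(X, Y)` holds, and in that case `X ∪ Y` induces an acyclic subgraph as well
and `e_X e_Y = e_{X ∪ Y}`. -/
theorem mainTheorem3 {V : Type*} [Finite V] (Θ : SimpleOrientedGraph V) (X Y : Set V)
    (hX : (Θ.induce X).IsAcyclic) (hY : (Θ.induce Y).IsAcyclic) :
    (IsIdempotentElem (Θ.e X hX * Θ.e Y hY) ↔ Θ.p X Y) ∧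
    (IsIdempotentElem (Θ.e X hX * Θ.e Y hY) →
      ∃ hXY : (Θ.induce (X ∪ Y)).IsAcyclic, Θ.e X hX * Θ.e Y hY = Θ.e (X ∪ Y) hXY) := by
  refine ⟨⟨SimpleOrientedGraph.p_of_isIdempotentElem hX hY, fun hp => hp.isIdempotentElem hX hY⟩,
    fun h => ?_⟩
  refine ⟨(SimpleOrientedGraph.p_of_isIdempotentElem hX hY h).isAcyclic_union hX hY,
    Θ.e_eq _ h ?_⟩
  rw [SimpleOrientedGraph.content_mul, (Θ.e_spec X hX).2, (Θ.e_spec Y hY).2]
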